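/- Let $(\Omega,\mathcal A,\mathbb P)$ be a probability space with a measurable flow $(\theta_x)_{x\in\mathbb R^d}$ on $\Omega$ (i.e. $(x,\omega)\mapsto\theta_x\omega$ is measurable, $\theta_0=\mathrm{id}$ and $\theta_{x+y}=\theta_x\circ\theta_y$) that leaves $\mathbb P$ invariant. Let $\Phi$ be a simple, locally finite point process on $\mathbb R^d$ that is compatible with the flow, $\Phi(\omega,B+x)=\Phi(\theta_x\omega,B)$ for all $\omega$, $x$ and Borel $B$, and has finite intensity $\lambda=\mathbb E[\Phi([0,1)^d)]$. Let $\mathbb P^0$ be the Palm probability of $\Phi$, $$\mathbb P^0(A)=\frac1\lambda\,\mathbb E\Big[\sum_{x\in\Phi\cap[0,1)^d}\mathbf 1_A(\theta_x\omega)\Big],$$ and $\mathbb E^0$ the expectation with respect to it. (Under $\mathbb P^0$ there is an atom $T_0=0$ at the origin.) (a) Let $\kappa:\Omega\times\mathbb R^d\to\mathbb R^d$ be a stationary association strategy: $\kappa$ is measurable, for every $x$ almost surely $\kappa(x)$ is a point of $\Phi$, and $\kappa(\omega,x)=\kappa(\theta_x\omega,0)+x$ for all $\omega$ and $x$. Let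 $\mathcal C(T_0)=\{y\in\mathbb R^d:\kappa(y)=0\}$ be the association cell of the atom at the origin. Then for every measurable $f:\Omega\to[0,\infty]$ $$\mathbb E[f]=\lambda\,\mathbb E^0\Big[\int_{\mathcal C(T_0)}f\circ\theta_u\,\mathrm du\Big].$$ (b) In particular, let a measurable family of fields $m_t(y)\in[0,\infty]$, $y\in\mathbb R^d$, be attached to the atoms $t$ of $\Phi$ such that, for every $\omega$, every atom $t$ of $\Phi(\omega)$ and every $y$, $m_0(y)\circ\theta_t=m_t(y+t)$ and $m_t(t)=\infty$. Suppose that for every $y$, almost surely, $\kappa(y)=\arg\sup_t m_t(y)$ is well defined, i.e. the supremum of $m_t(y)$ over the atoms $t$ is attained at exactly one atom. Then the formula of (a) holds for every measurable $f:\Omega\to[0,\infty]$, where $\mathcal C(T_0)$ is the set of those $y$ at which $m_0(y)>m_s(y)$ for all atoms $s\neq0$ (and is empty if there is no atom at $0$, an event of $\mathbb P^0$-probability zero). -/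

import Mathlib

open MeasureTheory
open scoped ENNReal

noncomputable section

namespace StationaryAssociation

/-- The space `ℝᵈ` with its Euclidean structure, Borel sets and Lebesgue measure `volume`. -/
abbrev Pt (d : ℕ) : Type := EuclideanSpace ℝ (Fin d)

/-- The half-open unit cube `[0,1)ᵈ`. -/
def unitCube (d : ℕ) : Set (Pt d) := {x | ∀ i, x i ∈ Set.Ico (0 : ℝ) 1}

/-- The points of a configuration, i.e. the locations charged by the measure. -/
def atoms {d : ℕ} (φ : Measure (Pt d)) : Set (Pt d) := {x | φ {x} ≠ 0}

/-- A simple locally finite counting measure: the counting measure of a set of points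
which has only finitely many elements in each compact set. -/
def IsSimpleCounting {d : ℕ} (φ : Measure (Pt d)) : Prop :=
  ∃ S : Set (Pt d), (∀ K : Set (Pt d), IsCompact K → (S ∩ K).Finite) ∧
    φ = Measure.count.restrict S

/-- A (simple) point process on `ℝᵈ`: a measurable map into the simple locally finite counting
measures. -/
structure IsPointProcess {d : ℕ} {Ω : Type*} [MeasurableSpace Ω]
    (Φ : Ω → Measure (Pt d)) : Prop where
  measurable : Measurable Φ
  simple : ∀ ω, IsSimpleCounting (Φ ω)

/-- Compatibility of `Φ` with the flow `θ_x ω = x +ᵥ ω`: `Φ(ω, B + x) = Φ(θ_x ω, B)`. -/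
def IsFlowCompatible {d : ℕ} {Ω : Type*} [AddAction (Pt d) Ω]
    (Φ : Ω → Measure (Pt d)) : Prop :=
  ∀ (ω : Ω) (x : Pt d) (B : Set (Pt d)), MeasurableSet B →
    Φ ω ((fun y => y + x) '' B) = Φ (x +ᵥ ω) B

/-- The intensity: the mean number of points in the unit cube. -/
def intensity {d : ℕ} {Ω : Type*} [MeasurableSpace Ω]
    (P : Measure Ω) (Φ : Ω → Measure (Pt d)) : ℝ≥0∞ :=
  ∫⁻ ω, Φ ω (unitCube d) ∂P

/-- The Palm probability of `Φ`,
`P⁰(A) = λ⁻¹ E[∑_{x ∈ Φ ∩ [0,1)ᵈ} 1_A(θ_x ω)]` (see `palm_apply`). -/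
def palm {d : ℕ} {Ω : Type*} [MeasurableSpace Ω] [AddAction (Pt d) Ω]
    (P : Measure Ω) (Φ : Ω → Measure (Pt d)) : Measure Ω :=
  (intensity P Φ)⁻¹ •
    P.bind (fun ω => ((Φ ω).restrict (unitCube d)).map (fun x => x +ᵥ ω))

/-- A stationary association strategy. Here `κ ω x` is the location of the access point that
serves a user at `x`; it is almost surely a point of `Φ`. Since `θ_x` moves the site `x` to the
origin, translation invariance reads `κ(ω, x) = κ(θ_x ω, 0) + x` in terms of locations. -/
structure IsStationaryAssociation {d : ℕ} {Ω : Type*} [MeasurableSpace Ω] [AddAction (Pt d) Ω]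
    (P : Measure Ω) (Φ : Ω → Measure (Pt d)) (κ : Ω → Pt d → Pt d) : Prop where
  measurable : Measurable (fun p : Ω × Pt d => κ p.1 p.2)
  mem_atoms : ∀ x, ∀ᵐ ω ∂P, κ ω x ∈ atoms (Φ ω)
  covariant : ∀ ω x, κ ω x = κ (x +ᵥ ω) 0 + x

/-- The association cell of an access point at `t`: the users served by it. -/
def assocCell {d : ℕ} {Ω : Type*} (κ : Ω → Pt d → Pt d) (ω : Ω) (t : Pt d) : Set (Pt d) :=
  {y | κ ω y = t}

/-- A mark field. Here `m ω t y` is the value at the site `y` of the field attached to the access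
point at `t`. An atom at `T` of `Φ(ω)` is the atom at `0` of `Φ(θ_T ω)`. -/
structure IsMarkField {d : ℕ} {Ω : Type*} [MeasurableSpace Ω] [AddAction (Pt d) Ω]
    (Φ : Ω → Measure (Pt d)) (m : Ω → Pt d → Pt d → ℝ≥0∞) : Prop where
  measurable : Measurable (fun p : Ω × Pt d × Pt d => m p.1 p.2.1 p.2.2)
  shift : ∀ ω, ∀ t ∈ atoms (Φ ω), ∀ y, m (t +ᵥ ω) 0 y = m ω t (y + t)
  self_eq_top : ∀ ω, ∀ t ∈ atoms (Φ ω), m ω t t = ∞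

/-- `t` is the (unique) point of the configuration `φ` at which `g` is maximal. -/
def IsArgSup {d : ℕ} (φ : Measure (Pt d)) (g : Pt d → ℝ≥0∞) (t : Pt d) : Prop :=
  t ∈ atoms φ ∧ ∀ s ∈ atoms φ, s ≠ t → g s < g t

/-- The association cell of an access point at `t` when each user at `y` is served by the access
point whose field is maximal at `y`. -/
def fieldCell {d : ℕ} {Ω : Type*} (Φ : Ω → Measure (Pt d)) (m : Ω → Pt d → Pt d → ℝ≥0∞)
    (ω : Ω) (t : Pt d) : Set (Pt d) :=
  {y | IsArgSup (Φ ω) (fun s => m ω s y) t}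

theorem measurableSet_unitCube (d : ℕ) : MeasurableSet (unitCube d) := by
  have h : unitCube d = ⋂ i, (fun x : Pt d => x i) ⁻¹' Set.Ico (0 : ℝ) 1 := by
    ext x; simp [unitCube]
  rw [h]
  exact MeasurableSet.iInter fun i => (by fun_prop : Measurable fun x : Pt d => x i)
    measurableSet_Ico

theorem unitCube_subset_isCompact (d : ℕ) : ∃ K : Set (Pt d), IsCompact K ∧ unitCube d ⊆ K := by
  refine ⟨Metric.closedBall 0 (Real.sqrt d), isCompact_closedBall _ _, fun x hx => ?_⟩
  rw [mem_closedBall_zero_iff, EuclideanSpace.norm_eq]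
  apply Real.sqrt_le_sqrt
  calc ∑ i, ‖x i‖ ^ 2 ≤ ∑ _i : Fin d, (1 : ℝ) := by
        refine Finset.sum_le_sum fun i _ => ?_
        have h := hx i
        rw [Real.norm_of_nonneg h.1]
        nlinarith [h.1, h.2]
    _ = d := by simp

theorem IsPointProcess.isFiniteMeasure_restrict {d : ℕ} {Ω : Type*} [MeasurableSpace Ω]
    {Φ : Ω → Measure (Pt d)} (hΦ : IsPointProcess Φ) (ω : Ω) :
    IsFiniteMeasure ((Φ ω).restrict (unitCube d)) := by
  obtain ⟨S, hS, hφ⟩ := hΦ.simple ω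
  obtain ⟨K, hK, hKs⟩ := unitCube_subset_isCompact d
  refine ⟨?_⟩
  rw [Measure.restrict_apply_univ, hφ, Measure.restrict_apply (measurableSet_unitCube d)]
  exact Measure.count_apply_lt_top.2
    ((hS K hK).subset fun x hx => ⟨hx.2, hKs hx.1⟩)

/-- The defining formula of the Palm probability. -/
theorem palm_apply {d : ℕ} {Ω : Type*} [MeasurableSpace Ω] [AddAction (Pt d) Ω]
    [MeasurableVAdd₂ (Pt d) Ω] (P : Measure Ω) {Φ : Ω → Measure (Pt d)} (hΦ : IsPointProcess Φ)
    {A : Set Ω} (hA : MeasurableSet A) :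
    palm P Φ A = (intensity P Φ)⁻¹ * ∫⁻ ω, Φ ω {x | x ∈ unitCube d ∧ x +ᵥ ω ∈ A} ∂P := by
  have hact : Measurable (fun p : Ω × Pt d => p.2 +ᵥ p.1) := measurable_snd.vadd measurable_fst
  have hcur (ω : Ω) : Measurable (fun x : Pt d => x +ᵥ ω) :=
    hact.comp measurable_prodMk_left
  have hval (ω : Ω) {B : Set Ω} (hB : MeasurableSet B) :
      ((Φ ω).restrict (unitCube d)).map (fun x => x +ᵥ ω) B
        = (Φ ω).restrict (unitCube d) (Prod.mk ω ⁻¹' ((fun p : Ω × Pt d => p.2 +ᵥ p.1) ⁻¹' B)) := by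
    rw [Measure.map_apply (hcur ω) hB]; rfl
  have hmeas : Measurable (fun ω => ((Φ ω).restrict (unitCube d)).map (fun x => x +ᵥ ω)) := by
    refine Measure.measurable_of_measurable_coe _ fun B hB => ?_
    simp_rw [hval _ hB]
    let k : ProbabilityTheory.Kernel Ω (Pt d) :=
      ⟨fun ω => (Φ ω).restrict (unitCube d),
        Measure.measurable_of_measurable_coe _ fun B hB => by
          simp_rw [Measure.restrict_apply hB]
          exact (Measure.measurable_coe (hB.inter (measurableSet_unitCube d))).comp
            hΦ.measurable⟩
    exact ProbabilityTheory.Kernel.measurable_kernel_prodMk_left_of_finite (κ := k) (hact hB)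
      hΦ.isFiniteMeasure_restrict
  rw [palm, Measure.smul_apply, smul_eq_mul, Measure.bind_apply hA hmeas.aemeasurable]
  congr 1
  refine lintegral_congr fun ω => ?_
  rw [hval ω hA, Measure.restrict_apply' (measurableSet_unitCube d)]
  congr 1
  ext x
  simp [and_comm]

end StationaryAssociation

end

open StationaryAssociation

/-!
Both formulas are instances of one mass transport identity,
`lintegral_eq_intensity_mul_lintegral_palm`, for a flow-covariant relation `C ω t y`, "the point at
`t` serves the user at `y`", under which the origin is almost surely served by exactly one point of
`Φ`. Write `Q` for the unit cube. By the definition of the Palm probability, `λ` times the Palm side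
is the mean over `ω` of the sum over the points `x ∈ Q` of `∫ f(θ_v ω) dv` over the cell of `x`,
because covariance turns the cell at the origin seen from `x` into the cell of `x` itself. By
Tonelli this is the integral over `v` of the mean of `f(θ_v ω) · #{x ∈ Q : x serves v}`; covariance
and invariance of `ℙ` under `θ_v` turn the mean into that of `f(ω) · #{x ∈ Q - v : x serves 0}`.
Integrating over `v` first, each point serving the origin contributes `vol(Q) = 1`, and there is
exactly one such point.

In the first part `C ω t y` is `κ ω y = t`. In the second it says that `t` is the unique maximizer
of the fields at `y`, so no selection of a measurable `κ` is needed; its joint measurability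
(`measurableSet_isArgSup`) and the interchanges of integrals rest on `Φ` being an s-finite kernel
(`isSFiniteKernel_of_finite_annuli`).
-/

/-! ### s-finite kernels -/

open ProbabilityTheory in
/-- A measurable family of measures, each finite on every annulus `n ≤ ‖x‖ < n + 1`, is an s-finite
kernel. A uniform bound in the parameter is recovered by also splitting the parameter space
according to the mass of the annulus. -/
theorem isSFiniteKernel_of_finite_annuli {α E : Type*} [MeasurableSpace α]
    [NormedAddCommGroup E] [MeasurableSpace E] [BorelSpace E] (K : Kernel α E)
    (hK : ∀ a n, K a {x | ⌊‖x‖⌋₊ = n} ≠ ∞) : IsSFiniteKernel K := by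
  classical
  have hB (n : ℕ) : MeasurableSet {x : E | ⌊‖x‖⌋₊ = n} :=
    (Nat.measurable_floor.comp measurable_norm) (measurableSet_singleton n)
  have hA (i : ℕ × ℕ) : MeasurableSet {a | ⌊(K a {x | ⌊‖x‖⌋₊ = i.1}).toReal⌋₊ = i.2} :=
    (Nat.measurable_floor.comp (K.measurable_coe (hB i.1)).ennreal_toReal)
      (measurableSet_singleton i.2)
  let κs : ℕ × ℕ → Kernel α E := fun i => Kernel.piecewise (hA i) (K.restrict (hB i.1)) 0
  have hκs (i) : IsSFiniteKernel (κs i) := by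
    have : IsFiniteKernel (κs i) := by
      refine ⟨⟨ENNReal.ofReal (i.2 + 1), ENNReal.ofReal_lt_top, fun a => ?_⟩⟩
      simp only [κs, Kernel.piecewise_apply]
      split_ifs with h
      · rw [Kernel.restrict_apply, Measure.restrict_apply_univ,
          ← ENNReal.ofReal_toReal (hK a i.1)]
        refine ENNReal.ofReal_le_ofReal ?_
        have h' : ⌊(K a {x | ⌊‖x‖⌋₊ = i.1}).toReal⌋₊ = i.2 := h
        rw [← h']
        exact (Nat.lt_floor_add_one _).le
      · simp
    infer_instance
  have hsum : K = Kernel.sum κs := by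
    ext a s hs
    rw [Kernel.sum_apply' _ _ hs, ENNReal.tsum_prod']
    have hin (n : ℕ) : ∑' k, κs (n, k) a s = K a (s ∩ {x | ⌊‖x‖⌋₊ = n}) := by
      rw [tsum_eq_single ⌊(K a {x | ⌊‖x‖⌋₊ = n}).toReal⌋₊]
      · simp [κs, Kernel.piecewise_apply, Kernel.restrict_apply, Measure.restrict_apply hs]
      · intro k hk
        simp [κs, Kernel.piecewise_apply, hk.symm]
    simp_rw [hin]
    rw [← measure_iUnion _ fun n => hs.inter (hB n)]
    · congr 1
      ext x
      simp
    · intro m n hmn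
      refine Set.disjoint_left.2 fun x hx hx' => hmn ?_
      exact hx.2.symm.trans hx'.2
  rw [hsum]
  infer_instance

namespace StationaryAssociation

open ProbabilityTheory

/-! ### Point processes as kernels -/

/-- A point process, seen as a kernel from the probability space to `ℝᵈ`. -/
def IsPointProcess.kernel {d : ℕ} {Ω : Type*} [MeasurableSpace Ω] {Φ : Ω → Measure (Pt d)}
    (hΦ : IsPointProcess Φ) : Kernel Ω (Pt d) :=
  ⟨Φ, hΦ.measurable⟩

theorem IsPointProcess.kernel_apply {d : ℕ} {Ω : Type*} [MeasurableSpace Ω]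
    {Φ : Ω → Measure (Pt d)} (hΦ : IsPointProcess Φ) (ω : Ω) : hΦ.kernel ω = Φ ω := rfl

instance {d : ℕ} {Ω : Type*} [MeasurableSpace Ω] {Φ : Ω → Measure (Pt d)}
    (hΦ : IsPointProcess Φ) : IsSFiniteKernel hΦ.kernel := by
  refine isSFiniteKernel_of_finite_annuli _ fun ω n => ?_
  obtain ⟨S, hS, hφ⟩ := hΦ.simple ω
  have hB : MeasurableSet {x : Pt d | ⌊‖x‖⌋₊ = n} :=
    (Nat.measurable_floor.comp measurable_norm) (measurableSet_singleton n)
  rw [hΦ.kernel_apply, hφ, Measure.restrict_apply hB]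
  refine (Measure.count_apply_lt_top.2 ((hS _ (isCompact_closedBall 0 ((n : ℝ) + 1))).subset ?_)).ne
  rintro x ⟨hx, hxS⟩
  refine ⟨hxS, ?_⟩
  rw [mem_closedBall_zero_iff]
  have hx' : ⌊‖x‖⌋₊ = n := hx
  rw [← hx']
  exact (Nat.lt_floor_add_one _).le

theorem IsPointProcess.apply_singleton {d : ℕ} {Ω : Type*} [MeasurableSpace Ω]
    {Φ : Ω → Measure (Pt d)} (hΦ : IsPointProcess Φ) {ω : Ω} {t : Pt d} (ht : t ∈ atoms (Φ ω)) :
    Φ ω {t} = 1 := by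
  obtain ⟨S, -, hφ⟩ := hΦ.simple ω
  have ht' : Φ ω {t} ≠ 0 := ht
  rw [hφ, Measure.restrict_apply (measurableSet_singleton t)] at ht' ⊢
  by_cases hS : t ∈ S
  · rw [Set.inter_eq_left.2 (Set.singleton_subset_iff.2 hS), Measure.count_singleton]
  · rw [Set.singleton_inter_eq_empty.2 hS] at ht'
    simp at ht'

theorem IsPointProcess.apply_eq_zero_iff {d : ℕ} {Ω : Type*} [MeasurableSpace Ω]
    {Φ : Ω → Measure (Pt d)} (hΦ : IsPointProcess Φ) (ω : Ω) {A : Set (Pt d)}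
    (hA : MeasurableSet A) : Φ ω A = 0 ↔ ∀ s ∈ atoms (Φ ω), s ∉ A := by
  refine ⟨fun h s hs hsA => hs (measure_mono_null (Set.singleton_subset_iff.2 hsA) h), fun h => ?_⟩
  obtain ⟨S, -, hφ⟩ := hΦ.simple ω
  rw [hφ, Measure.restrict_apply hA, Measure.count_eq_zero_iff]
  refine Set.eq_empty_iff_forall_notMem.2 fun s hs => h s ?_ hs.1
  have h1 : Φ ω {s} = 1 := by
    rw [hφ, Measure.restrict_apply (measurableSet_singleton s),
      Set.inter_eq_left.2 (Set.singleton_subset_iff.2 hs.2), Measure.count_singleton]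
  exact h1.trans_ne one_ne_zero

/-! ### The flow and the Palm probability -/

theorem volume_unitCube (d : ℕ) : volume (unitCube d) = 1 := by
  have h : unitCube d = WithLp.ofLp ⁻¹' (Set.univ.pi fun _ => Set.Ico (0 : ℝ) 1) := by
    ext x; simp [unitCube]
  rw [h, (PiLp.volume_preserving_ofLp (Fin d)).measure_preimage
    (MeasurableSet.univ_pi fun _ => measurableSet_Ico).nullMeasurableSet, volume_pi_pi]
  simp

theorem IsFlowCompatible.map_add {d : ℕ} {Ω : Type*} [AddAction (Pt d) Ω]
    {Φ : Ω → Measure (Pt d)} (hcomp : IsFlowCompatible Φ) (ω : Ω) (x : Pt d) {B : Set (Pt d)}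
    (hB : MeasurableSet B) : Φ (x +ᵥ ω) ((fun y => y + x) ⁻¹' B) = Φ ω B := by
  rw [← hcomp ω x _ ((measurable_add_const x) hB)]
  exact congrArg (Φ ω) (Set.image_preimage_eq B (Equiv.addRight x).surjective)

theorem IsFlowCompatible.mem_atoms_vadd {d : ℕ} {Ω : Type*} [AddAction (Pt d) Ω]
    {Φ : Ω → Measure (Pt d)} (hcomp : IsFlowCompatible Φ) {ω : Ω} {x t : Pt d} :
    t ∈ atoms (Φ (x +ᵥ ω)) ↔ t + x ∈ atoms (Φ ω) := by
  simp only [atoms, Set.mem_ofPred_eq]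
  rw [← hcomp.map_add ω x (measurableSet_singleton (t + x))]
  simp [Set.preimage]

/-- Integration against the Palm probability. The intensity is multiplied over to the left, where
it does no harm if it vanishes: both sides are then zero. -/
theorem intensity_mul_lintegral_palm {d : ℕ} {Ω : Type*} [MeasurableSpace Ω] [AddAction (Pt d) Ω]
    [MeasurableVAdd₂ (Pt d) Ω] (P : Measure Ω) {Φ : Ω → Measure (Pt d)} (hΦ : IsPointProcess Φ)
    (hint : intensity P Φ ≠ ∞) {g : Ω → ℝ≥0∞} (hg : Measurable g) :
    intensity P Φ * ∫⁻ ω, g ω ∂(palm P Φ) =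
      ∫⁻ ω, ∫⁻ x in unitCube d, g (x +ᵥ ω) ∂(Φ ω) ∂P := by
  have hact : Measurable (fun p : Ω × Pt d => p.2 +ᵥ p.1) := measurable_snd.vadd measurable_fst
  have hcur (ω : Ω) : Measurable (fun x : Pt d => x +ᵥ ω) := hact.comp measurable_prodMk_left
  have hmeas : Measurable (fun ω => ((Φ ω).restrict (unitCube d)).map (fun x => x +ᵥ ω)) := by
    refine Measure.measurable_of_measurable_coe _ fun B hB => ?_
    simp_rw [fun ω => Measure.map_apply (μ := (Φ ω).restrict (unitCube d)) (hcur ω) hB]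
    exact Kernel.measurable_kernel_prodMk_left
      (κ := hΦ.kernel.restrict (measurableSet_unitCube d)) (hact hB)
  rw [palm, lintegral_smul_measure, smul_eq_mul,
    Measure.lintegral_bind hmeas.aemeasurable hg.aemeasurable]
  simp_rw [fun ω => lintegral_map (μ := (Φ ω).restrict (unitCube d)) hg (hcur ω)]
  by_cases h0 : intensity P Φ = 0
  · have hz : ∀ᵐ ω ∂P, Φ ω (unitCube d) = 0 := by
      exact (lintegral_eq_zero_iff
        ((Measure.measurable_coe (measurableSet_unitCube d)).comp hΦ.measurable)).1 h0
    rw [h0, zero_mul, eq_comm]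
    refine lintegral_eq_zero_of_ae_eq_zero ?_
    filter_upwards [hz] with ω hω
    simp [Measure.restrict_eq_zero.2 hω]
  · rw [← mul_assoc, ENNReal.mul_inv_cancel h0 hint, one_mul]

/-! ### Mass transport -/

/-- Inverse Palm formula for a covariant relation `C ω t y` (read "the access point at `t` serves
the user at `y`") under which the origin is almost surely served by exactly one point of `Φ`.
This is the mass transport principle: the cell of a typical point, seen from that point, is
exchanged for the point serving a typical user, seen from that user. -/
theorem lintegral_eq_intensity_mul_lintegral_palm {d : ℕ} {Ω : Type*} [MeasurableSpace Ω]
    [AddAction (Pt d) Ω] [MeasurableVAdd₂ (Pt d) Ω] (P : Measure Ω) [SFinite P]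
    [VAddInvariantMeasure (Pt d) Ω P] {Φ : Ω → Measure (Pt d)} (hΦ : IsPointProcess Φ)
    (hcomp : IsFlowCompatible Φ) (hint : intensity P Φ ≠ ∞) {C : Ω → Pt d → Pt d → Prop}
    (hC : MeasurableSet {p : Ω × Pt d × Pt d | C p.1 p.2.1 p.2.2})
    (hcov : ∀ ω x t y, C (x +ᵥ ω) t y ↔ C ω (t + x) (y + x))
    (hone : ∀ᵐ ω ∂P, Φ ω {t | C ω t 0} = 1) {f : Ω → ℝ≥0∞} (hf : Measurable f) :
    ∫⁻ ω, f ω ∂P =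
      intensity P Φ * ∫⁻ ω, (∫⁻ u in {y | C ω 0 y}, f (u +ᵥ ω)) ∂(palm P Φ) := by
  classical
  have hQ := measurableSet_unitCube d
  have hSF (ω : Ω) : SFinite (Φ ω) := by
    rw [← hΦ.kernel_apply ω]; infer_instance
  have hact : Measurable (fun p : Pt d × Ω => p.1 +ᵥ p.2) := measurable_fst.vadd measurable_snd
  -- the indicator of `C`, as a jointly measurable function
  let c : Ω → Pt d → Pt d → ℝ≥0∞ := fun ω t y => {p : Pt d × Pt d | C ω p.1 p.2}.indicator 1 (t, y)
  have hc : Measurable (fun p : Ω × Pt d × Pt d => c p.1 p.2.1 p.2.2) :=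
    (measurable_one (α := ℝ≥0∞)).indicator hC
  have hccov (ω x t y) : c (x +ᵥ ω) t y = c ω (t + x) (y + x) := by
    simp only [c, Set.indicator_apply, Set.mem_ofPred_eq, hcov, Pi.one_apply]
  let q : Pt d → ℝ≥0∞ := (unitCube d).indicator 1
  have hq : Measurable q := measurable_one.indicator hQ
  have hcell (ω : Ω) : ∫⁻ u in {y | C ω 0 y}, f (u +ᵥ ω) = ∫⁻ u, c ω 0 u * f (u +ᵥ ω) := by
    have hm : MeasurableSet {y | C ω 0 y} :=
      (measurable_const.prodMk (measurable_const.prodMk measurable_id) :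
        Measurable fun y : Pt d => (ω, (0 : Pt d), y)) hC
    rw [← lintegral_indicator hm]
    refine lintegral_congr fun u => ?_
    by_cases hu : C ω 0 u <;> simp [c, hu]
  have hcell_meas : Measurable fun ω => ∫⁻ u, c ω 0 u * f (u +ᵥ ω) := by
    refine Measurable.lintegral_prod_right' (f := fun p : Ω × Pt d => c p.1 0 p.2 * f (p.2 +ᵥ p.1)) ?_
    exact (hc.comp (measurable_fst.prodMk (measurable_const.prodMk measurable_snd))).mul
      (hf.comp (hact.comp measurable_swap))
  -- the cell of `x` seen from `x`, translated back to `x`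
  have hshift (ω : Ω) (x : Pt d) : ∫⁻ u, c (x +ᵥ ω) 0 u * f (u +ᵥ (x +ᵥ ω)) =
      ∫⁻ v, c ω x v * f (v +ᵥ ω) := by
    rw [← lintegral_add_right_eq_self (fun v => c ω x v * f (v +ᵥ ω)) x]
    simp only [hccov, zero_add, vadd_vadd]
  -- `F v ω` is `f ω` times the number of points of `Q - v` that serve the origin
  let F : Pt d → Ω → ℝ≥0∞ := fun v ω => ∫⁻ x, q (x + v) * (c ω x 0 * f ω) ∂(Φ ω)
  have hF : Measurable (fun p : Ω × Pt d => F p.2 p.1) := by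
    refine Measurable.lintegral_kernel_prod_right' (κ := hΦ.kernel.prodMkRight (Pt d))
      (f := fun p : (Ω × Pt d) × Pt d => q (p.2 + p.1.2) * (c p.1.1 p.2 0 * f p.1.1)) ?_
    have h1 : Measurable fun p : (Ω × Pt d) × Pt d => c p.1.1 p.2 0 :=
      hc.comp ((measurable_fst.comp measurable_fst).prodMk (measurable_snd.prodMk measurable_const))
    fun_prop
  have hFshift (ω : Ω) (v : Pt d) : ∫⁻ x, q x * (c ω x v * f (v +ᵥ ω)) ∂(Φ ω) = F v (v +ᵥ ω) := by
    have hmap : Φ ω = (Φ (v +ᵥ ω)).map (fun x => x + v) := by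
      ext B hB
      rw [Measure.map_apply (measurable_add_const v) hB, hcomp.map_add ω v hB]
    have h1 : Measurable fun x => c ω x v :=
      hc.comp (measurable_const.prodMk (measurable_id.prodMk measurable_const))
    conv_lhs => rw [hmap]
    rw [lintegral_map (by fun_prop) (measurable_add_const v)]
    simp only [F, hccov, zero_add]
  symm
  simp_rw [hcell]
  rw [intensity_mul_lintegral_palm P hΦ hint hcell_meas]
  calc ∫⁻ ω, ∫⁻ x in unitCube d, (∫⁻ u, c (x +ᵥ ω) 0 u * f (u +ᵥ (x +ᵥ ω))) ∂(Φ ω) ∂P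
      = ∫⁻ ω, ∫⁻ x, (∫⁻ v, q x * (c ω x v * f (v +ᵥ ω))) ∂(Φ ω) ∂P := by
        refine lintegral_congr fun ω => ?_
        rw [← lintegral_indicator hQ]
        refine lintegral_congr fun x => ?_
        by_cases hx : x ∈ unitCube d <;> simp [q, hx, hshift]
    _ = ∫⁻ ω, (∫⁻ v, ∫⁻ x, q x * (c ω x v * f (v +ᵥ ω)) ∂(Φ ω)) ∂P := by
        refine lintegral_congr fun ω => ?_
        refine lintegral_lintegral_swap (Measurable.aemeasurable ?_)
        have h1 : Measurable fun p : Pt d × Pt d => c ω p.1 p.2 :=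
          hc.comp (measurable_const.prodMk measurable_id)
        have h2 : Measurable fun p : Pt d × Pt d => f (p.2 +ᵥ ω) :=
          hf.comp (hact.comp (measurable_snd.prodMk measurable_const))
        exact (hq.comp measurable_fst).mul (h1.mul h2)
    _ = ∫⁻ ω, (∫⁻ v, F v (v +ᵥ ω)) ∂P := by simp_rw [hFshift]
    _ = ∫⁻ v, ∫⁻ ω, F v (v +ᵥ ω) ∂P := by
        refine lintegral_lintegral_swap (Measurable.aemeasurable ?_)
        exact hF.comp ((hact.comp measurable_swap).prodMk measurable_snd)
    _ = ∫⁻ v, ∫⁻ ω, F v ω ∂P := by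
        refine lintegral_congr fun v => ?_
        exact (measurePreserving_vadd v P).lintegral_comp (hF.comp measurable_prodMk_right)
    _ = ∫⁻ ω, (∫⁻ v, F v ω) ∂P := (lintegral_lintegral_swap hF.aemeasurable).symm
    _ = ∫⁻ ω, f ω ∂P := by
        refine lintegral_congr_ae ?_
        filter_upwards [hone] with ω hω
        have h1 : Measurable fun x => c ω x 0 :=
          hc.comp (measurable_const.prodMk (measurable_id.prodMk measurable_const))
        have hm : MeasurableSet {t | C ω t 0} :=
          (measurable_const.prodMk (measurable_id.prodMk measurable_const) :
            Measurable fun t : Pt d => (ω, t, (0 : Pt d))) hC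
        -- a translate of the unit cube has volume one
        have hvol (x : Pt d) : ∫⁻ v, q (x + v) = 1 := by
          rw [lintegral_add_left_eq_self q x, lintegral_indicator_one hQ, volume_unitCube]
        simp only [F]
        rw [lintegral_lintegral_swap (Measurable.aemeasurable (by fun_prop))]
        calc ∫⁻ x, (∫⁻ v, q (x + v) * (c ω x 0 * f ω)) ∂(Φ ω)
            = ∫⁻ x, {t | C ω t 0}.indicator 1 x * f ω ∂(Φ ω) := by
              refine lintegral_congr fun x => ?_
              rw [lintegral_mul_const _ (by fun_prop), hvol, one_mul]
              rfl
          _ = f ω := by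
              rw [lintegral_mul_const _ (measurable_one.indicator hm), lintegral_indicator_one hm,
                hω, one_mul]

/-! ### Association strategies and mark fields -/

theorem IsStationaryAssociation.covariant_vadd {d : ℕ} {Ω : Type*} [MeasurableSpace Ω]
    [AddAction (Pt d) Ω] {P : Measure Ω} {Φ : Ω → Measure (Pt d)} {κ : Ω → Pt d → Pt d}
    (hκ : IsStationaryAssociation P Φ κ) (ω : Ω) (x y : Pt d) :
    κ (x +ᵥ ω) y + x = κ ω (y + x) := by
  rw [hκ.covariant (x +ᵥ ω) y, hκ.covariant ω (y + x), vadd_vadd, add_assoc]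

theorem IsMarkField.apply_vadd {d : ℕ} {Ω : Type*} [MeasurableSpace Ω] [AddAction (Pt d) Ω]
    {Φ : Ω → Measure (Pt d)} (hcomp : IsFlowCompatible Φ) {m : Ω → Pt d → Pt d → ℝ≥0∞}
    (hm : IsMarkField Φ m) {ω : Ω} {x t : Pt d} (ht : t ∈ atoms (Φ (x +ᵥ ω))) (y : Pt d) :
    m (x +ᵥ ω) t y = m ω (t + x) (y + x) := by
  have h1 := hm.shift (x +ᵥ ω) t ht (y - t)
  have h2 := hm.shift ω (t + x) (hcomp.mem_atoms_vadd.1 ht) (y - t)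
  rw [vadd_vadd, sub_add_cancel] at h1
  rw [← h1, h2]
  congr 1
  abel

/-- Covariance of the field cells. Marks are covariant at the atoms only, which suffices because
`IsArgSup` reads the fields of the atoms only. -/
theorem isArgSup_vadd {d : ℕ} {Ω : Type*} [MeasurableSpace Ω] [AddAction (Pt d) Ω]
    {Φ : Ω → Measure (Pt d)} (hcomp : IsFlowCompatible Φ) {m : Ω → Pt d → Pt d → ℝ≥0∞}
    (hm : IsMarkField Φ m) (ω : Ω) (x t y : Pt d) :
    IsArgSup (Φ (x +ᵥ ω)) (fun s => m (x +ᵥ ω) s y) t ↔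
      IsArgSup (Φ ω) (fun s => m ω s (y + x)) (t + x) := by
  have hval {s : Pt d} (hs : s ∈ atoms (Φ (x +ᵥ ω))) := hm.apply_vadd hcomp hs y
  constructor
  · rintro ⟨ht, hmax⟩
    refine ⟨hcomp.mem_atoms_vadd.1 ht, fun s hs hst => ?_⟩
    obtain ⟨s, rfl⟩ : ∃ s', s' + x = s := ⟨s - x, sub_add_cancel s x⟩
    have hs' := hcomp.mem_atoms_vadd.2 hs
    simpa only [hval hs', hval ht] using hmax s hs' fun h => hst (h ▸ rfl)
  · rintro ⟨ht, hmax⟩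
    have ht' := hcomp.mem_atoms_vadd.2 ht
    refine ⟨ht', fun s hs hst => ?_⟩
    simpa only [hval hs, hval ht'] using
      hmax (s + x) (hcomp.mem_atoms_vadd.1 hs) fun h => hst (add_right_cancel h)

/-- The maximality condition quantifies over the uncountable space `ℝᵈ`; it is measurable because it
says that the kernel `Φ` gives mass zero to a set depending measurably on the parameters. -/
theorem measurableSet_isArgSup {d : ℕ} {Ω : Type*} [MeasurableSpace Ω]
    {Φ : Ω → Measure (Pt d)} (hΦ : IsPointProcess Φ) {m : Ω → Pt d → Pt d → ℝ≥0∞}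
    (hm : Measurable (fun p : Ω × Pt d × Pt d => m p.1 p.2.1 p.2.2)) :
    MeasurableSet {p : Ω × Pt d × Pt d | IsArgSup (Φ p.1) (fun s => m p.1 s p.2.2) p.2.1} := by
  let A : Set ((Ω × Pt d × Pt d) × Pt d) :=
    {p | p.2 ≠ p.1.2.1 ∧ m p.1.1 p.1.2.1 p.1.2.2 ≤ m p.1.1 p.2 p.1.2.2}
  have hA : MeasurableSet A := by
    refine (measurableSet_eq_fun measurable_snd
      (measurable_fst.comp (measurable_snd.comp measurable_fst))).compl.inter
      (measurableSet_le (f := fun p : (Ω × Pt d × Pt d) × Pt d => m p.1.1 p.1.2.1 p.1.2.2)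
        (g := fun p : (Ω × Pt d × Pt d) × Pt d => m p.1.1 p.2 p.1.2.2) ?_ ?_)
    · exact hm.comp measurable_fst
    · exact hm.comp ((measurable_fst.comp measurable_fst).prodMk (measurable_snd.prodMk
        (measurable_snd.comp (measurable_snd.comp measurable_fst))))
  let D : Set ((Ω × Pt d × Pt d) × Pt d) := {p | p.2 = p.1.2.1}
  have hD : MeasurableSet D := measurableSet_eq_fun measurable_snd
    (measurable_fst.comp (measurable_snd.comp measurable_fst))
  let K := hΦ.kernel.prodMkRight (Pt d × Pt d)
  have hset : {p : Ω × Pt d × Pt d | IsArgSup (Φ p.1) (fun s => m p.1 s p.2.2) p.2.1} =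
      {p | K p (Prod.mk p ⁻¹' D) = 0}ᶜ ∩ {p | K p (Prod.mk p ⁻¹' A) = 0} := by
    ext ⟨ω, t, y⟩
    refine and_congr Iff.rfl (Iff.trans ?_ (hΦ.apply_eq_zero_iff ω (measurable_prodMk_left hA)).symm)
    refine forall_congr' fun s => ?_
    simp only [A, Set.mem_preimage, Set.mem_ofPred_eq, ← not_lt]
    tauto
  rw [hset]
  exact (Kernel.measurable_kernel_prodMk_left hD (measurableSet_singleton 0)).compl.inter
    (Kernel.measurable_kernel_prodMk_left hA (measurableSet_singleton 0))

end StationaryAssociation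

theorem proposition1 {d : ℕ} {Ω : Type*} [MeasurableSpace Ω]
    [AddAction (Pt d) Ω] [MeasurableVAdd₂ (Pt d) Ω]
    (P : Measure Ω) [IsProbabilityMeasure P]
    [VAddInvariantMeasure (Pt d) Ω P]
    (Φ : Ω → Measure (Pt d))
    (hΦ : IsPointProcess Φ)
    (hcomp : IsFlowCompatible Φ)
    (hint : intensity P Φ ≠ ∞) :
    (∀ κ : Ω → Pt d → Pt d,
      IsStationaryAssociation P Φ κ →
      ∀ f : Ω → ℝ≥0∞, Measurable f →
        ∫⁻ ω, f ω ∂P = intensity P Φ *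
          ∫⁻ ω, (∫⁻ u in assocCell κ ω 0, f (u +ᵥ ω))
            ∂(palm P Φ)) ∧
    (∀ m : Ω → Pt d → Pt d → ℝ≥0∞,
      IsMarkField Φ m →
      (∀ y, ∀ᵐ ω ∂P, ∃ t, IsArgSup (Φ ω) (fun s => m ω s y) t) →
      ∀ f : Ω → ℝ≥0∞, Measurable f →
        ∫⁻ ω, f ω ∂P = intensity P Φ *
          ∫⁻ ω, (∫⁻ u in fieldCell Φ m ω 0, f (u +ᵥ ω))
            ∂(palm P Φ)) := by
  refine ⟨fun κ hκ f hf => ?_, fun m hm hsup f hf => ?_⟩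
  · refine lintegral_eq_intensity_mul_lintegral_palm P hΦ hcomp hint
      (C := fun ω t y => κ ω y = t) ?_ (fun ω x t y => ?_) ?_ hf
    · exact measurableSet_eq_fun
        (hκ.measurable.comp (measurable_fst.prodMk (measurable_snd.comp measurable_snd)))
        (measurable_fst.comp measurable_snd)
    · rw [← hκ.covariant_vadd ω x y, add_left_inj]
    · filter_upwards [hκ.mem_atoms 0] with ω hω
      simpa only [Set.ofPred_eq_eq_singleton'] using hΦ.apply_singleton hω
  · refine lintegral_eq_intensity_mul_lintegral_palm P hΦ hcomp hint
      (C := fun ω t y => IsArgSup (Φ ω) (fun s => m ω s y) t)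
      (measurableSet_isArgSup hΦ hm.measurable) (isArgSup_vadd hcomp hm) ?_ hf
    filter_upwards [hsup 0] with ω ⟨t, ht⟩
    have hset : {s | IsArgSup (Φ ω) (fun s => m ω s 0) s} = {t} := by
      refine Set.eq_singleton_iff_unique_mem.2 ⟨ht, fun s hs => ?_⟩
      by_contra hst
      exact lt_asymm (ht.2 s hs.1 hst) (hs.2 t ht.1 (Ne.symm hst))
    rw [hset, hΦ.apply_singleton ht.1]
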